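/- Let $n\ge 1$ and let $\mathbf p=[p_0\ \ldots\ p_{n-1}]$, $\mathbf q=[q_0\ \ldots\ q_{n-1}]$ be real row vectors. Let $\mathbf S$ denote a square shift matrix (all zero except ones on the superdiagonal, of the dimension given by the context), $\mathbf r=[0\ \ldots\ 0\ 1]^T\in\mathbb R^n$ and $\mathbf Q=\mathbf S-\mathbf r\mathbf q$. Suppose that $f_Z(z)=\mathbf p\,\mathrm e^{z\mathbf Q}\,\mathbf r$ is a probability density on $[0,\infty)$ (a matrix-exponential density; its Laplace transform is $p(s)/q(s)$ with $p(s)=\sum_{i<n}p_is^i$ and $q(s)=s^n+\sum_{i<n}q_is^i$). Consider persistent HARQ with rate $R>0$ and decoding threshold $\Theta\ge 0$ over the effective channel $Z_1,Z_2,\ldots$, i.i.d. random variables with density $f_Z$: in timeslot $t$ the current packet is transmitted and the receiver adds $Z_t$ to what it has accumulated for that packet; the packet is decoded as soon as the accumulated sum is at least $\Theta$, and a new packet (with nothing accumulated) starts in the next timeslot; otherwise the same packet is retransmitted, with no limit on the number of attempts. Let $N_k$ be the number of packets decoded in the first $k$ timeslots, and for $\theta>0$ let $$C_{\mathrm{eff}}(\theta)=-\lim_{k\to\infty}\frac1{\theta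 k}\ln \mathbb E\{\mathrm e^{-\theta R N_k}\}$$ be the effective capacity at QoS-exponent $\theta$. Let $\psi=\ln(\eta/\epsilon)/D_{\max}$ with $0<\epsilon<\eta$ and $D_{\max}>0$, and let $C_{\mathrm{eff}}(\psi)$ denote the effective capacity expressed in the QoS-parameter $\psi$, that is, $C_{\mathrm{eff}}(\theta^*)$ for a $\theta^*>0$ with $\theta^*C_{\mathrm{eff}}(\theta^*)=\psi$. Then the limit $C_{\mathrm{eff}}(\theta)$ exists for every $\theta>0$; and $C_{\mathrm{eff}}(\psi)$ exists, is uniquely determined, and equals $$C_{\mathrm{eff}}(\psi)=\frac{R}{\psi^{-1}\ln\left(\mathbf a\,\mathrm e^{\Theta\mathbf B}\,\mathbf c\right)},$$ where $\mathbf a=[(\mathbf q-\mathbf p)\mathrm e^{\psi}\ \ \mathrm e^{\psi}]$ (a row vector of length $n+1$), $\mathbf c=[0;\mathbf r]$ (a column vector of length $n+1$), $\mathbf B=\mathbf S-\mathbf c\,[0\ \ (\mathbf q-\mathbf p\,\mathrm e^{\psi})]$ (an $(n+1)\times(n+1)$ matrix), and $\mathbf a\,\mathrm e^{\Theta\mathbf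 B}\,\mathbf c>1$. -/

import Mathlib

open scoped Matrix

noncomputable section

namespace HARQ

/-- The shift matrix: zero except for ones on the superdiagonal. -/
def shiftMatrix (n : ℕ) : Matrix (Fin n) (Fin n) ℝ :=
  Matrix.of fun i j => if (i : ℕ) + 1 = (j : ℕ) then 1 else 0

/-- The column vector `r = [0 0 … 0 1]ᵀ`. -/
def lastVec (n : ℕ) : Fin n → ℝ := fun i => if (i : ℕ) + 1 = n then 1 else 0

/-- The matrix `Q = S - r q` of a matrix-exponential distribution. -/
def medMatrix {n : ℕ} (q : Fin n → ℝ) : Matrix (Fin n) (Fin n) ℝ :=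
  shiftMatrix n - Matrix.vecMulVec (lastVec n) q

/-- The function `z ↦ p e^{zQ} r`, with `Q = S - r q`. -/
def medDensity {n : ℕ} (p q : Fin n → ℝ) (z : ℝ) : ℝ :=
  p ⬝ᵥ (NormedSpace.exp (z • medMatrix q) *ᵥ lastVec n)

/-- `z ↦ p e^{zQ} r` is a probability density function on `[0, ∞)`. -/
structure IsMEDPdf {n : ℕ} (p q : Fin n → ℝ) : Prop where
  nonneg : ∀ z : ℝ, 0 ≤ z → 0 ≤ medDensity p q z
  lintegral_eq_one : ∫⁻ z in Set.Ici (0 : ℝ), ENNReal.ofReal (medDensity p q z) = 1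

/-- The measure on `ℝ` with density `p e^{zQ} r` on `[0, ∞)` (and density zero on `(-∞, 0)`). -/
def medMeasure {n : ℕ} (p q : Fin n → ℝ) : MeasureTheory.Measure ℝ :=
  (MeasureTheory.volume.restrict (Set.Ici (0 : ℝ))).withDensity
    fun z => ENNReal.ofReal (medDensity p q z)

/-- Persistent HARQ run on the realization `z 0, z 1, …` of the effective channel in the successive
timeslots, with decoding threshold `Θ`. The state after `k` timeslots is the pair (what the receiver
has accumulated for the packet in transmission, number of packets decoded so far). A transmission
fails as long as the accumulated amount is below `Θ`, and the same packet is then retransmitted,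
without any limit on the number of attempts; once it is at least `Θ` the packet is decoded, and the
next timeslot starts a new packet with nothing accumulated. -/
def persistentState (Θ : ℝ) (z : ℕ → ℝ) : ℕ → ℝ × ℕ
  | 0 => (0, 0)
  | k + 1 =>
    if (persistentState Θ z k).1 + z k < Θ then
      ((persistentState Θ z k).1 + z k, (persistentState Θ z k).2)
    else (0, (persistentState Θ z k).2 + 1)

/-- The number `N_k` of packets decoded in the first `k` timeslots. -/
def decodedPackets (Θ : ℝ) (z : ℕ → ℝ) (k : ℕ) : ℕ := (persistentState Θ z k).2

/-- `C = - lim_{k → ∞} (1 / (θ k)) ln E[e^{-θ R N_k}]`: the (existing) effective capacity at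
QoS-exponent `θ` of a scheme delivering packets of rate `R` with service process `N`. -/
def IsEffectiveCapacity {Ω : Type*} [MeasurableSpace Ω] (μ : MeasureTheory.Measure Ω)
    (N : ℕ → Ω → ℕ) (R θ C : ℝ) : Prop :=
  Filter.Tendsto
    (fun k : ℕ => -(1 / (θ * (k : ℝ)) * Real.log (∫ ω, Real.exp (-(θ * R * (N k ω : ℝ))) ∂μ)))
    Filter.atTop (nhds C)

/-- `C` is the effective capacity expressed in the QoS-parameter `ψ`: it is the effective capacity
at a QoS-exponent `θ > 0` that solves `θ C(θ) = ψ`. -/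
def IsEffectiveCapacityAtQoS {Ω : Type*} [MeasurableSpace Ω] (μ : MeasureTheory.Measure Ω)
    (N : ℕ → Ω → ℕ) (R ψ C : ℝ) : Prop :=
  ∃ θ : ℝ, 0 < θ ∧ IsEffectiveCapacity μ N R θ C ∧ θ * C = ψ

/-- The row vector `a = [(q - p) e^ψ, e^ψ]`: the coefficients, in ascending order, of
`e^ψ (q(s) - p(s))`, where `q(s)` is monic of degree `n` and `deg p(s) < n`. -/
def capVecA {n : ℕ} (p q : Fin n → ℝ) (ψ : ℝ) : Fin (n + 1) → ℝ :=
  Fin.snoc (α := fun _ => ℝ) (Real.exp ψ • (q - p)) (Real.exp ψ)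

/-- The column vector `c = [0; r]`. -/
def capVecC (n : ℕ) : Fin (n + 1) → ℝ := Fin.cons (α := fun _ => ℝ) 0 (lastVec n)

/-- The matrix `B = S - c [0 (q - p e^ψ)]`. -/
def capMatB {n : ℕ} (p q : Fin n → ℝ) (ψ : ℝ) : Matrix (Fin (n + 1)) (Fin (n + 1)) ℝ :=
  shiftMatrix (n + 1) -
    Matrix.vecMulVec (capVecC n) (Fin.cons (α := fun _ => ℝ) 0 (q - Real.exp ψ • p))

/-- The scalar `a e^{ΘB} c`. -/
def capScalar {n : ℕ} (p q : Fin n → ℝ) (ψ Θ : ℝ) : ℝ :=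
  capVecA p q ψ ⬝ᵥ (NormedSpace.exp (Θ • capMatB p q ψ) *ᵥ capVecC n)

end HARQ

end

noncomputable section

namespace HARQ

/-! ### Derivatives of matrix exponentials applied to vectors. -/

section MatrixExponential

variable {m : ℕ}

attribute [local instance] Matrix.linftyOpNormedRing Matrix.linftyOpNormedAlgebra

/-! Write `g` for `capExcess`, `W = 1 + (e^ψ - 1) g` for `capScalar` and `f` for the density. The
vector `e^{tB} c` solves a linear system that encodes the renewal equation `g(t) = 1 + e^ψ ∫₀ᵗ f(y)
g(t - y) dy` (`capExcess_integral_eq`). Hence, if `x W(Θ) = 1`, the function `x^m W(Θ - a)` of the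
HARQ state `(a, m)` is multiplied by `e^{-ψ}` in mean at each timeslot
(`integral_potential_persistentStep`), and its mean after `k` slots is `e^{-kψ} W(Θ)`. Since `W`
lies between 1 and a constant on `[0, Θ]`, `E[x^{N_k}]` is `e^{-kψ}` up to constant factors. With `x
= e^{-θR}`, this gives the effective capacity `ψ/θ` whenever `W(Θ) = e^{θR}`. Such a `ψ ≥ 0` exists
for each `θ > 0` by the intermediate value theorem in `ψ`; reading the relation backwards gives the
formula. -/

theorem hasDerivAt_exp_smul_mulVec (A : Matrix (Fin m) (Fin m) ℝ) (v : Fin m → ℝ) (t : ℝ) :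
    HasDerivAt (fun t : ℝ => NormedSpace.exp (t • A) *ᵥ v)
      (A *ᵥ (NormedSpace.exp (t • A) *ᵥ v)) t := by
  have h := hasDerivAt_exp_smul_const' (𝕂 := ℝ) A t
  let l : Matrix (Fin m) (Fin m) ℝ →ₗ[ℝ] (Fin m → ℝ) :=
    { toFun := fun M => M *ᵥ v
      map_add' := fun M N => Matrix.add_mulVec M N v
      map_smul' := fun c M => Matrix.smul_mulVec c M v }
  have h2 := (LinearMap.toContinuousLinearMap l).hasFDerivAt.comp_hasDerivAt t h
  rw [Matrix.mulVec_mulVec]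
  exact h2

theorem hasDerivAt_vecMul_exp_smul (A : Matrix (Fin m) (Fin m) ℝ) (v : Fin m → ℝ) (t : ℝ) :
    HasDerivAt (fun t : ℝ => v ᵥ* NormedSpace.exp (t • A))
      ((v ᵥ* NormedSpace.exp (t • A)) ᵥ* A) t := by
  have h := hasDerivAt_exp_smul_const (𝕂 := ℝ) A t
  let l : Matrix (Fin m) (Fin m) ℝ →ₗ[ℝ] (Fin m → ℝ) :=
    { toFun := fun M => v ᵥ* M
      map_add' := fun M N => Matrix.vecMul_add M N v
      map_smul' := fun c M => Matrix.vecMul_smul v c M }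
  have h2 := (LinearMap.toContinuousLinearMap l).hasFDerivAt.comp_hasDerivAt t h
  rw [Matrix.vecMul_vecMul]
  exact h2

theorem continuous_matrix_exp :
    Continuous (NormedSpace.exp : Matrix (Fin m) (Fin m) ℝ → Matrix (Fin m) (Fin m) ℝ) :=
  NormedSpace.exp_continuous

end MatrixExponential

theorem hasDerivAt_dotProduct {m : ℕ} {u w : ℝ → Fin m → ℝ} {u' w' : Fin m → ℝ} {t : ℝ}
    (hu : HasDerivAt u u' t) (hw : HasDerivAt w w' t) :
    HasDerivAt (fun s => u s ⬝ᵥ w s) (u' ⬝ᵥ w t + u t ⬝ᵥ w') t := by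
  rw [hasDerivAt_pi] at hu hw
  simp only [dotProduct]
  rw [← Finset.sum_add_distrib]
  exact HasDerivAt.fun_sum fun i _ => (hu i).mul (hw i)

/-- The solution `t ↦ e^{tB} c` of the linear system with matrix `B` started at `c`. -/
def capFlow {n : ℕ} (p q : Fin n → ℝ) (ψ t : ℝ) : Fin (n + 1) → ℝ :=
  NormedSpace.exp (t • capMatB p q ψ) *ᵥ capVecC n

/-- The scalar `[q, 1] e^{tB} c`. -/
def capExcess {n : ℕ} (p q : Fin n → ℝ) (ψ t : ℝ) : ℝ :=
  q ⬝ᵥ (fun i => capFlow p q ψ t i.castSucc) + capFlow p q ψ t (Fin.last n)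

/-! ### The flow `e^{tB} c`, its renewal equation and the resulting bounds. -/

section Flow

variable {n : ℕ} (p q : Fin n → ℝ) (ψ t : ℝ)

theorem shiftMatrix_mulVec_castSucc (w : Fin (n + 1) → ℝ) (i : Fin n) :
    (shiftMatrix (n + 1) *ᵥ w) i.castSucc = w i.succ := by
  simp only [Matrix.mulVec, dotProduct, shiftMatrix, Matrix.of_apply, Fin.val_castSucc, ite_mul,
    one_mul, zero_mul]
  rw [Finset.sum_eq_single i.succ]
  · simp
  · intro j _ hj
    rw [if_neg]
    intro h
    exact hj (Fin.ext (by simpa using h.symm))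
  · simp

theorem shiftMatrix_mulVec_last (w : Fin (n + 1) → ℝ) :
    (shiftMatrix (n + 1) *ᵥ w) (Fin.last n) = 0 := by
  simp only [Matrix.mulVec, dotProduct, shiftMatrix, Matrix.of_apply, Fin.val_last, ite_mul,
    one_mul, zero_mul]
  refine Finset.sum_eq_zero fun j _ => if_neg ?_
  have := j.isLt
  omega

theorem shiftMatrix_mulVec_comp_castSucc (w : Fin (n + 1) → ℝ) (i : Fin n) :
    (shiftMatrix n *ᵥ fun j => w j.castSucc) i
      = w i.succ - lastVec n i * w (Fin.last n) := by
  simp only [Matrix.mulVec, dotProduct, shiftMatrix, Matrix.of_apply, ite_mul,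
    one_mul, zero_mul, lastVec]
  by_cases h : (i : ℕ) + 1 = n
  · rw [Finset.sum_eq_zero, if_pos h]
    · have : i.succ = Fin.last n := Fin.ext (by simpa using h)
      simp [this]
    · intro j _
      rw [if_neg]
      have := j.isLt
      omega
  · have hlt : (i : ℕ) + 1 < n := by have := i.isLt; omega
    rw [Finset.sum_eq_single ⟨(i : ℕ) + 1, hlt⟩, if_neg h]
    · simp [Fin.succ, Fin.castSucc, Fin.castAdd, Fin.castLE]
    · intro j _ hj
      rw [if_neg]
      intro h'
      exact hj (Fin.ext (by simpa using h'.symm))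
    · simp

theorem capVecC_castSucc (i : Fin n) : capVecC n i.castSucc = 0 := by
  rcases n with _ | n
  · exact i.elim0
  · refine Fin.cases ?_ (fun j => ?_) i
    · simp [capVecC]
    · rw [← Fin.succ_castSucc]
      simp only [capVecC, Fin.cons_succ, lastVec, Fin.val_castSucc]
      rw [if_neg]
      have := j.isLt
      omega

theorem capVecC_last (hn : 0 < n) : capVecC n (Fin.last n) = 1 := by
  obtain ⟨n, rfl⟩ := Nat.exists_eq_succ_of_ne_zero hn.ne'
  rw [← Fin.succ_last]
  simp [capVecC, lastVec]

/-- Truncating before shifting loses the last entry of `w`; together with the rank-one term of `Q`,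
the defect is `[q, 1] w` times `r`. This is where `capExcess` comes from. -/
theorem medMatrix_mulVec_comp_castSucc (w : Fin (n + 1) → ℝ) (i : Fin n) :
    (medMatrix q *ᵥ fun j => w j.castSucc) i
      = w i.succ - (q ⬝ᵥ (fun j => w j.castSucc) + w (Fin.last n)) * lastVec n i := by
  rw [medMatrix, Matrix.sub_mulVec, Pi.sub_apply, shiftMatrix_mulVec_comp_castSucc,
    Matrix.vecMulVec_mulVec]
  simp
  ring

theorem capMatB_mulVec_apply (w : Fin (n + 1) → ℝ) (i : Fin (n + 1)) :
    (capMatB p q ψ *ᵥ w) i = (shiftMatrix (n + 1) *ᵥ w) i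
      - ((q - Real.exp ψ • p) ⬝ᵥ fun j => w j.succ) * capVecC n i := by
  rw [capMatB, Matrix.sub_mulVec, Pi.sub_apply, Matrix.vecMulVec_mulVec]
  congr 1
  have : (Fin.cons (α := fun _ => ℝ) 0 (q - Real.exp ψ • p) : Fin (n + 1) → ℝ) ⬝ᵥ w
      = (q - Real.exp ψ • p) ⬝ᵥ fun j => w j.succ := by
    simp [dotProduct, Fin.sum_univ_succ]
  rw [this]
  simp [mul_comm]

theorem capFlow_zero : capFlow p q ψ 0 = capVecC n := by
  simp [capFlow]

theorem hasDerivAt_capFlow :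
    HasDerivAt (capFlow p q ψ) (capMatB p q ψ *ᵥ capFlow p q ψ t) t :=
  hasDerivAt_exp_smul_mulVec _ _ _

theorem hasDerivAt_capFlow_castSucc :
    HasDerivAt (fun t => fun i : Fin n => capFlow p q ψ t i.castSucc)
      (fun i => capFlow p q ψ t i.succ) t := by
  rw [hasDerivAt_pi]
  intro i
  have h := (hasDerivAt_pi.1 (hasDerivAt_capFlow p q ψ t)) i.castSucc
  rwa [capMatB_mulVec_apply, shiftMatrix_mulVec_castSucc, capVecC_castSucc, mul_zero,
    sub_zero] at h

theorem hasDerivAt_capFlow_last (hn : 0 < n) :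
    HasDerivAt (fun t => capFlow p q ψ t (Fin.last n))
      (-((q - Real.exp ψ • p) ⬝ᵥ fun j => capFlow p q ψ t j.succ)) t := by
  have h := (hasDerivAt_pi.1 (hasDerivAt_capFlow p q ψ t)) (Fin.last n)
  rwa [capMatB_mulVec_apply, shiftMatrix_mulVec_last, capVecC_last hn, mul_one, zero_sub] at h

/-- `[q - e^ψ p, 1] e^{tB} c = 1`, since `[q - e^ψ p, 1] B = 0`. -/
theorem dotProduct_capFlow_add_last (hn : 0 < n) :
    (q - Real.exp ψ • p) ⬝ᵥ (fun i => capFlow p q ψ t i.castSucc)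
      + capFlow p q ψ t (Fin.last n) = 1 := by
  have hd : ∀ s, HasDerivAt (fun s => (q - Real.exp ψ • p) ⬝ᵥ
      (fun i => capFlow p q ψ s i.castSucc) + capFlow p q ψ s (Fin.last n)) 0 s := by
    intro s
    have h := (hasDerivAt_dotProduct (hasDerivAt_const s (q - Real.exp ψ • p))
      (hasDerivAt_capFlow_castSucc p q ψ s)).add (hasDerivAt_capFlow_last p q ψ s hn)
    refine h.congr_deriv ?_
    simp
  have h := is_const_of_deriv_eq_zero (fun s => (hd s).differentiableAt) (fun s => (hd s).deriv) t 0
  rw [h, capFlow_zero]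
  simp [capVecC_castSucc, capVecC_last hn, dotProduct]

theorem capExcess_eq (hn : 0 < n) :
    capExcess p q ψ t
      = 1 + Real.exp ψ * (p ⬝ᵥ fun i => capFlow p q ψ t i.castSucc) := by
  have h := dotProduct_capFlow_add_last p q ψ t hn
  rw [sub_dotProduct, smul_dotProduct, smul_eq_mul] at h
  rw [capExcess]
  linarith

/-- As `a = e^ψ ([q, 1] - [p, 0])`, the conserved quantity of the flow eliminates the `p` term. -/
theorem capScalar_eq (hn : 0 < n) :
    capScalar p q ψ t = 1 + (Real.exp ψ - 1) * capExcess p q ψ t := by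
  have h1 : capScalar p q ψ t = Real.exp ψ * ((q - p) ⬝ᵥ (fun i => capFlow p q ψ t i.castSucc))
      + Real.exp ψ * capFlow p q ψ t (Fin.last n) := by
    change capVecA p q ψ ⬝ᵥ capFlow p q ψ t = _
    rw [dotProduct, Fin.sum_univ_castSucc]
    simp [capVecA, dotProduct, Finset.mul_sum, mul_assoc]
  have h2 := capExcess_eq p q ψ t hn
  rw [h1, sub_dotProduct]
  have h3 : q ⬝ᵥ (fun i => capFlow p q ψ t i.castSucc)
      = capExcess p q ψ t - capFlow p q ψ t (Fin.last n) := by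
    rw [capExcess]; ring
  rw [h3]
  linear_combination h2

theorem continuous_capExcess : Continuous (capExcess p q ψ) := by
  have h : Continuous (capFlow p q ψ) :=
    continuous_iff_continuousAt.2 fun t => (hasDerivAt_capFlow p q ψ t).continuousAt
  unfold capExcess dotProduct
  fun_prop

theorem continuous_medDensity : Continuous (medDensity p q) := by
  have h : Continuous fun z : ℝ => NormedSpace.exp (z • medMatrix q) *ᵥ lastVec n :=
    continuous_iff_continuousAt.2 fun t => (hasDerivAt_exp_smul_mulVec _ _ t).continuousAt
  unfold medDensity dotProduct
  fun_prop

/-- Duhamel's formula: the truncated flow `u` satisfies `u' = Q u + g r`, so the integrand is the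
derivative of `-p e^{yQ} u(t - y)`, and `u(0) = 0` kills the endpoint `y = t`. -/
theorem integral_medDensity_mul_capExcess :
    ∫ y in (0 : ℝ)..t, medDensity p q y * capExcess p q ψ (t - y)
      = p ⬝ᵥ fun i => capFlow p q ψ t i.castSucc := by
  have hd : ∀ y : ℝ, HasDerivAt
      (fun y => -((p ᵥ* NormedSpace.exp (y • medMatrix q)) ⬝ᵥ
        fun i => capFlow p q ψ (t - y) i.castSucc))
      (medDensity p q y * capExcess p q ψ (t - y)) y := by
    intro y
    have hw := (hasDerivAt_capFlow_castSucc p q ψ (t - y)).scomp y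
      ((hasDerivAt_id y).const_sub t)
    have h := (hasDerivAt_dotProduct (hasDerivAt_vecMul_exp_smul (medMatrix q) p y) hw).neg
    refine h.congr_deriv ?_
    simp only [Function.comp_apply]
    rw [← Matrix.dotProduct_mulVec, ← dotProduct_add, medDensity, Matrix.dotProduct_mulVec,
      ← dotProduct_neg]
    have : -((medMatrix q *ᵥ fun i => capFlow p q ψ (t - y) i.castSucc)
        + (-1 : ℝ) • fun i : Fin n => capFlow p q ψ (t - y) i.succ)
        = capExcess p q ψ (t - y) • lastVec n := by
      funext i
      rw [Pi.neg_apply, Pi.add_apply, medMatrix_mulVec_comp_castSucc, capExcess]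
      simp
    rw [this, dotProduct_smul, smul_eq_mul, mul_comm]
  rw [intervalIntegral.integral_eq_sub_of_hasDerivAt (fun y _ => hd y)
    (((continuous_medDensity p q).mul ((continuous_capExcess p q ψ).comp
      (continuous_const.sub continuous_id))).intervalIntegrable _ _)]
  simp [capFlow_zero, capVecC_castSucc, dotProduct]

theorem capExcess_integral_eq (hn : 0 < n) :
    capExcess p q ψ t = 1 + Real.exp ψ *
      ∫ y in (0 : ℝ)..t, medDensity p q y * capExcess p q ψ (t - y) := by
  rw [integral_medDensity_mul_capExcess, capExcess_eq p q ψ t hn]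

variable {p q t} in
-- At a first time `τ` with `g(τ) ≤ 0` the renewal integral involves only earlier, positive values
-- of `g`, so `g(τ) ≥ 1`.
theorem capExcess_pos (hn : 0 < n) (hf : ∀ y, 0 ≤ y → 0 ≤ medDensity p q y) (ht : 0 ≤ t) :
    0 < capExcess p q ψ t := by
  by_contra! hneg
  set s : Set ℝ := {u | 0 ≤ u ∧ capExcess p q ψ u ≤ 0} with hs
  have hclosed : IsClosed s := (isClosed_Ici).inter
    (isClosed_le (continuous_capExcess p q ψ) continuous_const)
  have hbdd : BddBelow s := ⟨0, fun u hu => hu.1⟩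
  have hmem : sInf s ∈ s := hclosed.csInf_mem ⟨t, ht, hneg⟩ hbdd
  set τ := sInf s
  have hnn : 0 ≤ ∫ y in (0 : ℝ)..τ, medDensity p q y * capExcess p q ψ (τ - y) := by
    refine intervalIntegral.integral_nonneg_of_ae_restrict hmem.1 ?_
    -- The point `y = 0` is discarded because there `g` is evaluated at `τ` itself.
    filter_upwards [MeasureTheory.ae_restrict_mem measurableSet_Icc,
      MeasureTheory.ae_restrict_of_ae (MeasureTheory.Measure.ae_ne MeasureTheory.volume 0)]
      with y hy hy0
    have hy0 : 0 < y := lt_of_le_of_ne hy.1 (Ne.symm hy0)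
    refine mul_nonneg (hf y hy.1) (le_of_lt ?_)
    by_contra! hle
    have := csInf_le hbdd (show τ - y ∈ s from ⟨sub_nonneg.2 hy.2, hle⟩)
    linarith
  have := capExcess_integral_eq p q ψ τ hn
  have h2 := hmem.2
  have := mul_nonneg (Real.exp_pos ψ).le hnn
  linarith

variable {p q t} in
theorem one_le_capExcess (hn : 0 < n) (hf : ∀ y, 0 ≤ y → 0 ≤ medDensity p q y) (ht : 0 ≤ t) :
    1 ≤ capExcess p q ψ t := by
  have hnn : 0 ≤ ∫ y in (0 : ℝ)..t, medDensity p q y * capExcess p q ψ (t - y) :=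
    intervalIntegral.integral_nonneg ht fun y hy =>
      mul_nonneg (hf y hy.1) (capExcess_pos ψ hn hf (sub_nonneg.2 hy.2)).le
  have := mul_nonneg (Real.exp_pos ψ).le hnn
  rw [capExcess_integral_eq p q ψ t hn]
  linarith

variable {p q ψ t} in
theorem exp_le_capScalar (hn : 0 < n) (hf : ∀ y, 0 ≤ y → 0 ≤ medDensity p q y) (hψ : 0 ≤ ψ)
    (ht : 0 ≤ t) : Real.exp ψ ≤ capScalar p q ψ t := by
  rw [capScalar_eq p q ψ t hn]
  nlinarith [one_le_capExcess ψ hn hf ht, Real.one_le_exp hψ]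

theorem continuous_capScalar_right (hn : 0 < n) : Continuous (capScalar p q ψ) := by
  have h : capScalar p q ψ = fun t => 1 + (Real.exp ψ - 1) * capExcess p q ψ t :=
    funext fun t => capScalar_eq p q ψ t hn
  rw [h]
  exact continuous_const.add (continuous_const.mul (continuous_capExcess p q ψ))

theorem continuous_capScalar : Continuous fun ψ => capScalar p q ψ t := by
  have h : Continuous fun ψ => capMatB p q ψ := by
    unfold capMatB
    refine continuous_const.sub (continuous_const.matrix_vecMulVec ?_)
    refine continuous_pi fun i => ?_
    refine Fin.cases ?_ (fun j => ?_) i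
    · simpa using continuous_const
    · simp
      fun_prop
  have h2 : Continuous fun ψ => capVecA p q ψ := by
    unfold capVecA
    refine continuous_pi fun i => ?_
    refine Fin.lastCases ?_ (fun j => ?_) i
    · simpa using Real.continuous_exp
    · simp
      fun_prop
  unfold capScalar
  exact h2.dotProduct ((continuous_matrix_exp.comp (h.const_smul t)).matrix_mulVec continuous_const)

end Flow

open MeasureTheory ProbabilityTheory Filter Topology

theorem IsMEDPdf.pos {n : ℕ} {p q : Fin n → ℝ} (h : IsMEDPdf p q) : 0 < n := by
  rcases n with _ | n
  · have := h.lintegral_eq_one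
    simp [medDensity] at this
  · exact n.succ_pos

theorem isProbabilityMeasure_medMeasure {n : ℕ} {p q : Fin n → ℝ} (h : IsMEDPdf p q) :
    IsProbabilityMeasure (medMeasure p q) :=
  ⟨by rw [medMeasure, withDensity_apply _ MeasurableSet.univ, Measure.restrict_univ,
    h.lintegral_eq_one]⟩

theorem ae_nonneg_medMeasure {n : ℕ} (p q : Fin n → ℝ) : ∀ᵐ y ∂(medMeasure p q), 0 ≤ y :=
  (withDensity_absolutelyContinuous _ _).ae_le (ae_restrict_mem measurableSet_Ici)

/-! ### The HARQ state as a Markov recursion. -/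

section State

variable (Θ : ℝ)

/-- The transition of the HARQ state when the channel realization in the timeslot is `y`. -/
def persistentStep (s : ℝ × ℕ) (y : ℝ) : ℝ × ℕ :=
  if s.1 + y < Θ then (s.1 + y, s.2) else (0, s.2 + 1)

theorem persistentState_succ (z : ℕ → ℝ) (k : ℕ) :
    persistentState Θ z (k + 1) = persistentStep Θ (persistentState Θ z k) (z k) := rfl

theorem measurable_persistentStep :
    Measurable fun s : (ℝ × ℕ) × ℝ => persistentStep Θ s.1 s.2 := by
  unfold persistentStep
  refine Measurable.ite (measurableSet_lt (by fun_prop) measurable_const) (by fun_prop) ?_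
  exact measurable_const.prodMk
    ((measurable_of_countable (fun m : ℕ => m + 1)).comp (by fun_prop))

theorem measurable_persistentState (k : ℕ) :
    Measurable fun z : ℕ → ℝ => persistentState Θ z k := by
  induction k with
  | zero => exact measurable_const
  | succ k ih => exact (measurable_persistentStep Θ).comp (ih.prodMk (measurable_pi_apply k))

theorem persistentState_congr {z z' : ℕ → ℝ} {k : ℕ} (h : ∀ i < k, z i = z' i) :
    persistentState Θ z k = persistentState Θ z' k := by
  induction k with
  | zero => rfl
  | succ k ih =>
    rw [persistentState_succ, persistentState_succ, ih fun i hi => h i (by omega),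
      h k (by omega)]

variable {Θ} in
theorem persistentState_fst_mem_Icc (hΘ : 0 ≤ Θ) {z : ℕ → ℝ} (hz : ∀ i, 0 ≤ z i) (k : ℕ) :
    (persistentState Θ z k).1 ∈ Set.Icc 0 Θ := by
  induction k with
  | zero => exact ⟨le_rfl, hΘ⟩
  | succ k ih =>
    rw [persistentState_succ, persistentStep]
    split_ifs with h
    · exact ⟨add_nonneg ih.1 (hz k), h.le⟩
    · exact ⟨le_rfl, hΘ⟩

theorem indepFun_persistentState {Ω : Type*} [MeasurableSpace Ω] {μ : Measure Ω}
    {Z : ℕ → Ω → ℝ} (hZ_meas : ∀ t, Measurable (Z t)) (hZ_indep : iIndepFun Z μ) (k : ℕ) :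
    IndepFun (fun ω => persistentState Θ (fun t => Z t ω) k) (Z k) μ := by
  have h := hZ_indep.indepFun_finset (Finset.range k) {k} (by simp) hZ_meas
  -- The state after `k` slots depends only on the first `k` realizations, so padding them with
  -- zeros loses nothing.
  let e : (Finset.range k → ℝ) → ℕ → ℝ := fun v i =>
    if hi : i ∈ Finset.range k then v ⟨i, hi⟩ else 0
  have he : Measurable e := by
    refine measurable_pi_lambda _ fun i => ?_
    by_cases hi : i ∈ Finset.range k
    · simp only [e, dif_pos hi]
      exact measurable_pi_apply _
    · simp only [e, dif_neg hi]
      exact measurable_const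
  have h2 := h.comp ((measurable_persistentState Θ k).comp he)
    (measurable_pi_apply (⟨k, by simp⟩ : ({k} : Finset ℕ)))
  have h3 : (fun ω => persistentState Θ (fun t => Z t ω) k)
      = ((fun z => persistentState Θ z k) ∘ e) ∘ fun ω (i : Finset.range k) => Z i ω := by
    funext ω
    refine persistentState_congr Θ fun i hi => ?_
    simp [e, hi]
  rw [h3]
  exact h2

end State

/-! ### The eigenfunction of the transition operator. -/

section Potential

variable {n : ℕ} (p q : Fin n → ℝ) (ψ Θ x : ℝ)

/-- `(a, m) ↦ x ^ m W(Θ - a)`, where `W(t)` is the scalar `a e^{tB} c`. For `x W(Θ) = 1` it is an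
eigenfunction of the HARQ state process, with eigenvalue `e^{-ψ}`. -/
def potential (s : ℝ × ℕ) : ℝ := x ^ s.2 * capScalar p q ψ (Θ - s.1)

theorem measurable_potential (hn : 0 < n) : Measurable (potential p q ψ Θ x) := by
  unfold potential
  refine ((measurable_of_countable (fun m : ℕ => x ^ m)).comp measurable_snd).mul ?_
  exact (continuous_capScalar_right p q ψ hn).measurable.comp (by fun_prop)

variable {p q ψ Θ x}

/-- On decoding, `x W(Θ) = 1` absorbs the extra factor `x`, leaving `x^m`; so both outcomes share
the term 1 and only failure contributes `g`. -/
theorem potential_persistentStep (hn : 0 < n) (hx : x * capScalar p q ψ Θ = 1) (s : ℝ × ℕ)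
    (y : ℝ) :
    potential p q ψ Θ x (persistentStep Θ s y) = x ^ s.2 * (1 + (Real.exp ψ - 1) *
      (Set.Iio (Θ - s.1)).indicator (fun y => capExcess p q ψ (Θ - s.1 - y)) y) := by
  unfold potential persistentStep
  by_cases h : s.1 + y < Θ
  · rw [if_pos h, Set.indicator_of_mem (show y ∈ Set.Iio (Θ - s.1) from lt_sub_iff_add_lt'.2 h),
      capScalar_eq _ _ _ _ hn, sub_sub]
  · rw [if_neg h, Set.indicator_of_notMem
      (show y ∉ Set.Iio (Θ - s.1) from fun hy => h (lt_sub_iff_add_lt'.1 hy))]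
    simp only [sub_zero, mul_zero, add_zero, pow_succ, mul_assoc, hx]

theorem medDensity_smul_indicator (t : ℝ) (hpdf : IsMEDPdf p q) :
    (fun y => (ENNReal.ofReal (medDensity p q y)).toReal •
      (Set.Iio t).indicator (fun y => capExcess p q ψ (t - y)) y)
    =ᵐ[volume.restrict (Set.Ici 0)]
    (Set.Iio t).indicator (fun y => medDensity p q y * capExcess p q ψ (t - y)) := by
  filter_upwards [ae_restrict_mem measurableSet_Ici] with y hy
  rw [ENNReal.toReal_ofReal (hpdf.nonneg y hy), Set.indicator_mul_right]
  rfl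

theorem integrable_indicator_capExcess (hpdf : IsMEDPdf p q) (t : ℝ) :
    Integrable ((Set.Iio t).indicator fun y => capExcess p q ψ (t - y)) (medMeasure p q) := by
  rw [medMeasure, integrable_withDensity_iff_integrable_smul'
    (continuous_medDensity p q).measurable.ennreal_ofReal (by simp),
    integrable_congr (medDensity_smul_indicator t hpdf), integrable_indicator_iff measurableSet_Iio,
    IntegrableOn, Measure.restrict_restrict measurableSet_Iio]
  have hc : Continuous fun y => medDensity p q y * capExcess p q ψ (t - y) :=
    (continuous_medDensity p q).mul ((continuous_capExcess p q ψ).comp (by fun_prop))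
  exact (hc.integrableOn_Icc (a := 0) (b := t)).mono_set fun y hy => ⟨hy.2, le_of_lt hy.1⟩

theorem integral_indicator_capExcess (hpdf : IsMEDPdf p q) {t : ℝ} (ht : 0 ≤ t) :
    ∫ y, (Set.Iio t).indicator (fun y => capExcess p q ψ (t - y)) y ∂(medMeasure p q)
      = ∫ y in (0 : ℝ)..t, medDensity p q y * capExcess p q ψ (t - y) := by
  rw [medMeasure, integral_withDensity_eq_integral_toReal_smul
    (continuous_medDensity p q).measurable.ennreal_ofReal (by simp),
    integral_congr_ae (medDensity_smul_indicator t hpdf), integral_indicator measurableSet_Iio,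
    Measure.restrict_restrict measurableSet_Iio, Set.inter_comm, Set.Ici_inter_Iio,
    intervalIntegral.integral_of_le ht, integral_Ico_eq_integral_Ioo, integral_Ioc_eq_integral_Ioo]

/-- With `I` the renewal integral, the mean is `x^m (1 + (e^ψ - 1) I)`, while `g = 1 + e^ψ I` gives
`W = e^ψ (1 + (e^ψ - 1) I)`. -/
theorem integral_potential_persistentStep (hpdf : IsMEDPdf p q) (hx : x * capScalar p q ψ Θ = 1)
    {s : ℝ × ℕ} (hs : s.1 ≤ Θ) :
    ∫ y, potential p q ψ Θ x (persistentStep Θ s y) ∂(medMeasure p q)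
      = Real.exp (-ψ) * potential p q ψ Θ x s := by
  have := isProbabilityMeasure_medMeasure hpdf
  simp_rw [potential_persistentStep hpdf.pos hx]
  rw [integral_const_mul, integral_add (integrable_const _)
    ((integrable_indicator_capExcess hpdf _).const_mul _), integral_const_mul,
    integral_indicator_capExcess hpdf (sub_nonneg.2 hs), potential,
    capScalar_eq _ _ _ _ hpdf.pos]
  have h := capExcess_integral_eq p q ψ (Θ - s.1) hpdf.pos
  have he : Real.exp (-ψ) * Real.exp ψ = 1 := by rw [← Real.exp_add]; simp
  simp only [integral_const, probReal_univ, smul_eq_mul, mul_one]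
  generalize (∫ y in (0 : ℝ)..(Θ - s.1), medDensity p q y * capExcess p q ψ (Θ - s.1 - y)) = I at *
  rw [h]
  linear_combination (-x ^ s.2 * (1 + (Real.exp ψ - 1) * I)) * he

end Potential

/-! ### Growth rate of `E[x^{N_k}]` and the effective capacity. -/

section ServiceProcess

variable {Ω : Type*} [MeasurableSpace Ω] {μ : Measure Ω}
  {n : ℕ} {p q : Fin n → ℝ} {Z : ℕ → Ω → ℝ} {ψ Θ x : ℝ}

theorem ae_persistentState_fst_mem_Icc (hZ_meas : ∀ t, Measurable (Z t))
    (hZ_law : ∀ t, μ.map (Z t) = medMeasure p q) (hΘ : 0 ≤ Θ) :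
    ∀ᵐ ω ∂μ, ∀ k, (persistentState Θ (fun t => Z t ω) k).1 ∈ Set.Icc 0 Θ := by
  have h : ∀ᵐ ω ∂μ, ∀ t, 0 ≤ Z t ω := ae_all_iff.2 fun t =>
    ae_of_ae_map (hZ_meas t).aemeasurable (by rw [hZ_law t]; exact ae_nonneg_medMeasure p q)
  filter_upwards [h] with ω hω k
  exact persistentState_fst_mem_Icc hΘ hω k

theorem measurable_persistentState_comp (hZ_meas : ∀ t, Measurable (Z t)) (k : ℕ) :
    Measurable fun ω => persistentState Θ (fun t => Z t ω) k :=
  (measurable_persistentState Θ k).comp (measurable_pi_lambda _ hZ_meas)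

variable [IsProbabilityMeasure μ]

theorem exists_capScalar_le (hn : 0 < n) (p q : Fin n → ℝ) (ψ Θ : ℝ) :
    ∃ K, ∀ a ∈ Set.Icc 0 Θ, capScalar p q ψ (Θ - a) ≤ K := by
  obtain ⟨K, hK⟩ := (isCompact_Icc (a := (0 : ℝ)) (b := Θ)).bddAbove_image
    (f := fun a => capScalar p q ψ (Θ - a))
    ((continuous_capScalar_right p q ψ hn).comp (by fun_prop)).continuousOn
  exact ⟨K, fun a ha => hK ⟨a, ha, rfl⟩⟩

theorem integrable_potential (hpdf : IsMEDPdf p q) (hZ_meas : ∀ t, Measurable (Z t))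
    (hZ_law : ∀ t, μ.map (Z t) = medMeasure p q) (hΘ : 0 ≤ Θ) (hψ : 0 ≤ ψ) (hx0 : 0 ≤ x)
    (hx1 : x ≤ 1) (k : ℕ) :
    Integrable (fun ω => potential p q ψ Θ x (persistentState Θ (fun t => Z t ω) k)) μ := by
  obtain ⟨K, hK⟩ := exists_capScalar_le hpdf.pos p q ψ Θ
  refine Integrable.of_bound ((measurable_potential p q ψ Θ x hpdf.pos).comp
    (measurable_persistentState_comp hZ_meas k)).aestronglyMeasurable K ?_
  filter_upwards [ae_persistentState_fst_mem_Icc hZ_meas hZ_law hΘ] with ω hω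
  have h0 : 0 ≤ capScalar p q ψ (Θ - (persistentState Θ (fun t => Z t ω) k).1) :=
    (Real.exp_pos ψ).le.trans
      (exp_le_capScalar hpdf.pos hpdf.nonneg hψ (sub_nonneg.2 (hω k).2))
  rw [potential, Real.norm_eq_abs, abs_of_nonneg (mul_nonneg (pow_nonneg hx0 _) h0)]
  exact (mul_le_of_le_one_left h0 (pow_le_one₀ hx0 hx1)).trans (hK _ (hω k))

/-- The current state is independent of the next realization, so Fubini reduces the claim to the
one-step identity, valid almost surely since the accumulated amount stays at most `Θ`. -/
theorem integral_potential_succ (hpdf : IsMEDPdf p q) (hZ_meas : ∀ t, Measurable (Z t))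
    (hZ_indep : iIndepFun Z μ) (hZ_law : ∀ t, μ.map (Z t) = medMeasure p q) (hΘ : 0 ≤ Θ)
    (hψ : 0 ≤ ψ) (hx0 : 0 ≤ x) (hx1 : x ≤ 1) (hx : x * capScalar p q ψ Θ = 1) (k : ℕ) :
    ∫ ω, potential p q ψ Θ x (persistentState Θ (fun t => Z t ω) (k + 1)) ∂μ
      = Real.exp (-ψ) * ∫ ω, potential p q ψ Θ x (persistentState Θ (fun t => Z t ω) k) ∂μ := by
  have := isProbabilityMeasure_medMeasure hpdf
  have hS := measurable_persistentState_comp (Θ := Θ) hZ_meas k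
  have hΦ := measurable_potential p q ψ Θ x hpdf.pos
  set S : Ω → ℝ × ℕ := fun ω => persistentState Θ (fun t => Z t ω) k with hSdef
  have hSprob : IsProbabilityMeasure (μ.map S) := Measure.isProbabilityMeasure_map hS.aemeasurable
  have hprod : μ.map (fun ω => (S ω, Z k ω)) = (μ.map S).prod (medMeasure p q) := by
    rw [(indepFun_iff_map_prod_eq_prod_map_map hS.aemeasurable (hZ_meas k).aemeasurable).1
      (indepFun_persistentState Θ hZ_meas hZ_indep k), hZ_law k]
  have hG : Measurable fun r : (ℝ × ℕ) × ℝ => potential p q ψ Θ x (persistentStep Θ r.1 r.2) :=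
    hΦ.comp (measurable_persistentStep Θ)
  have hpair : Measurable fun ω => (S ω, Z k ω) := hS.prodMk (hZ_meas k)
  have hint : Integrable (fun r : (ℝ × ℕ) × ℝ => potential p q ψ Θ x (persistentStep Θ r.1 r.2))
      ((μ.map S).prod (medMeasure p q)) := by
    rw [← hprod, integrable_map_measure hG.aestronglyMeasurable hpair.aemeasurable]
    exact integrable_potential hpdf hZ_meas hZ_law hΘ hψ hx0 hx1 (k + 1)
  have hae : ∀ᵐ s ∂(μ.map S), s.1 ≤ Θ := by
    rw [ae_map_iff hS.aemeasurable (measurableSet_le measurable_fst measurable_const)]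
    filter_upwards [ae_persistentState_fst_mem_Icc hZ_meas hZ_law hΘ] with ω hω
    exact (hω k).2
  calc ∫ ω, potential p q ψ Θ x (persistentStep Θ (S ω) (Z k ω)) ∂μ
      = ∫ r, potential p q ψ Θ x (persistentStep Θ r.1 r.2) ∂((μ.map S).prod (medMeasure p q)) := by
        rw [← hprod, integral_map hpair.aemeasurable hG.aestronglyMeasurable]
    _ = ∫ s, ∫ y, potential p q ψ Θ x (persistentStep Θ s y) ∂(medMeasure p q) ∂(μ.map S) :=
        integral_prod _ hint
    _ = ∫ s, Real.exp (-ψ) * potential p q ψ Θ x s ∂(μ.map S) := by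
        refine integral_congr_ae ?_
        filter_upwards [hae] with s hs
        exact integral_potential_persistentStep hpdf hx hs
    _ = _ := by
        rw [integral_const_mul, integral_map hS.aemeasurable hΦ.aestronglyMeasurable]

theorem integral_potential (hpdf : IsMEDPdf p q) (hZ_meas : ∀ t, Measurable (Z t))
    (hZ_indep : iIndepFun Z μ) (hZ_law : ∀ t, μ.map (Z t) = medMeasure p q) (hΘ : 0 ≤ Θ)
    (hψ : 0 ≤ ψ) (hx0 : 0 ≤ x) (hx1 : x ≤ 1) (hx : x * capScalar p q ψ Θ = 1) (k : ℕ) :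
    ∫ ω, potential p q ψ Θ x (persistentState Θ (fun t => Z t ω) k) ∂μ
      = Real.exp (-(k * ψ)) * capScalar p q ψ Θ := by
  induction k with
  | zero => simp [persistentState, potential]
  | succ k ih =>
    rw [integral_potential_succ hpdf hZ_meas hZ_indep hZ_law hΘ hψ hx0 hx1 hx, ih, ← mul_assoc,
      ← Real.exp_add]
    congr 2
    push_cast
    ring

theorem exists_bounds_integral_pow_decodedPackets (hpdf : IsMEDPdf p q)
    (hZ_meas : ∀ t, Measurable (Z t))
    (hZ_indep : iIndepFun Z μ) (hZ_law : ∀ t, μ.map (Z t) = medMeasure p q) (hΘ : 0 ≤ Θ)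
    (hψ : 0 ≤ ψ) (hx0 : 0 ≤ x) (hx1 : x ≤ 1) (hx : x * capScalar p q ψ Θ = 1) :
    ∃ b c : ℝ, 0 < b ∧ 0 < c ∧ ∀ k : ℕ,
      b * Real.exp (-(k * ψ)) ≤ ∫ ω, x ^ decodedPackets Θ (fun t => Z t ω) k ∂μ ∧
      ∫ ω, x ^ decodedPackets Θ (fun t => Z t ω) k ∂μ ≤ c * Real.exp (-(k * ψ)) := by
  obtain ⟨K, hK⟩ := exists_capScalar_le hpdf.pos p q ψ Θ
  have hW1 : ∀ a ∈ Set.Icc 0 Θ, 1 ≤ capScalar p q ψ (Θ - a) := fun a ha =>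
    (Real.one_le_exp hψ).trans (exp_le_capScalar hpdf.pos hpdf.nonneg hψ (sub_nonneg.2 ha.2))
  have hΘ0 : (0 : ℝ) ∈ Set.Icc 0 Θ := ⟨le_rfl, hΘ⟩
  have hW : 0 < capScalar p q ψ Θ := by
    have := hW1 0 hΘ0
    rw [sub_zero] at this
    linarith
  have hK0 : 0 < K := zero_lt_one.trans_le ((hW1 0 hΘ0).trans (hK 0 hΘ0))
  have hmeas : ∀ k, Measurable fun ω => x ^ decodedPackets Θ (fun t => Z t ω) k := fun k =>
    (measurable_of_countable (fun m : ℕ => x ^ m)).comp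
      (measurable_persistentState_comp hZ_meas k).snd
  have hint : ∀ k, Integrable (fun ω => x ^ decodedPackets Θ (fun t => Z t ω) k) μ := fun k => by
    refine Integrable.of_bound (hmeas k).aestronglyMeasurable 1 (ae_of_all _ fun ω => ?_)
    rw [Real.norm_eq_abs, abs_of_nonneg (pow_nonneg hx0 _)]
    exact pow_le_one₀ hx0 hx1
  refine ⟨capScalar p q ψ Θ / K, capScalar p q ψ Θ, div_pos hW hK0, hW, fun k => ?_⟩
  have hΦ := integral_potential hpdf hZ_meas hZ_indep hZ_law hΘ hψ hx0 hx1 hx k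
  have hΦint := integrable_potential hpdf hZ_meas hZ_law hΘ hψ hx0 hx1 k
  have hA := ae_persistentState_fst_mem_Icc hZ_meas hZ_law hΘ
  constructor
  · rw [div_mul_eq_mul_div, div_le_iff₀ hK0, mul_comm, ← hΦ, ← integral_mul_const]
    refine integral_mono_ae hΦint ((hint k).mul_const K) ?_
    filter_upwards [hA] with ω hω
    exact mul_le_mul_of_nonneg_left (hK _ (hω k)) (pow_nonneg hx0 _)
  · rw [mul_comm, ← hΦ]
    refine integral_mono_ae (hint k) hΦint ?_
    filter_upwards [hA] with ω hω
    exact le_mul_of_one_le_right (pow_nonneg hx0 _) (hW1 _ (hω k))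

theorem isEffectiveCapacity_decodedPackets {R θ : ℝ} (hpdf : IsMEDPdf p q)
    (hZ_meas : ∀ t, Measurable (Z t)) (hZ_indep : iIndepFun Z μ)
    (hZ_law : ∀ t, μ.map (Z t) = medMeasure p q) (hΘ : 0 ≤ Θ) (hψ : 0 ≤ ψ) (hR : 0 < R)
    (hθ : 0 < θ) (hW : capScalar p q ψ Θ = Real.exp (θ * R)) :
    IsEffectiveCapacity μ (fun k ω => decodedPackets Θ (fun t => Z t ω) k) R θ (ψ / θ) := by
  have hx : Real.exp (-(θ * R)) * capScalar p q ψ Θ = 1 := by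
    rw [hW, ← Real.exp_add]; simp
  obtain ⟨b, c, hb, hc, hbc⟩ := exists_bounds_integral_pow_decodedPackets hpdf hZ_meas hZ_indep
    hZ_law hΘ hψ (Real.exp_pos _).le (Real.exp_le_one_iff.2 (by have := mul_pos hθ hR; linarith)) hx
  have hpow : ∀ m : ℕ, Real.exp (-(θ * R * (m : ℝ))) = Real.exp (-(θ * R)) ^ m := fun m => by
    rw [← Real.exp_nat_mul]; congr 1; ring
  unfold IsEffectiveCapacity
  simp_rw [hpow]
  set g : ℕ → ℝ := fun k => ∫ ω, Real.exp (-(θ * R)) ^ decodedPackets Θ (fun t => Z t ω) k ∂μ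
  have hd : ∀ k : ℕ, Real.log b ≤ Real.log (g k) + k * ψ ∧
      Real.log (g k) + k * ψ ≤ Real.log c := fun k => by
    obtain ⟨h1, h2⟩ := hbc k
    have hpos := mul_pos hb (Real.exp_pos (-(k * ψ)))
    have l1 := Real.log_le_log hpos h1
    have l2 := Real.log_le_log (hpos.trans_le h1) h2
    rw [Real.log_mul hb.ne' (Real.exp_pos _).ne', Real.log_exp] at l1
    rw [Real.log_mul hc.ne' (Real.exp_pos _).ne', Real.log_exp] at l2
    constructor <;> linarith
  have hz : Tendsto (fun k : ℕ => 1 / (θ * (k : ℝ))) atTop (𝓝 0) := by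
    have := (tendsto_natCast_atTop_atTop (R := ℝ)).const_mul_atTop hθ
    simp only [one_div]
    exact this.inv_tendsto_atTop
  have hlim : Tendsto (fun k : ℕ => 1 / (θ * (k : ℝ)) * (Real.log (g k) + k * ψ)) atTop (𝓝 0) := by
    have h := fun C : ℝ => hz.mul_const C
    simp only [zero_mul] at h
    refine tendsto_of_tendsto_of_tendsto_of_le_of_le (h (Real.log b)) (h (Real.log c))
      (fun k => ?_) (fun k => ?_)
    · exact mul_le_mul_of_nonneg_left (hd k).1 (by positivity)
    · exact mul_le_mul_of_nonneg_left (hd k).2 (by positivity)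
  have h := hlim.const_sub (ψ / θ)
  rw [sub_zero] at h
  refine h.congr' ?_
  -- At `k = 0` division by zero yields 0 and the identity can fail.
  filter_upwards [eventually_gt_atTop 0] with k hk
  have hk' : (k : ℝ) ≠ 0 := Nat.cast_ne_zero.2 hk.ne'
  field_simp
  ring

end ServiceProcess

/-! ### Solving `W(Θ) = e^{θR}` for `ψ`, and the main theorem. -/

theorem capScalar_zero_left {n : ℕ} (hn : 0 < n) (p q : Fin n → ℝ) (t : ℝ) :
    capScalar p q 0 t = 1 := by
  simp [capScalar_eq p q 0 t hn]

/-- On `[0, y]` the continuous map `ψ ↦ W(Θ)` starts at 1 and ends at a value at least `e^y`. -/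
theorem exists_capScalar_eq_exp {n : ℕ} {p q : Fin n → ℝ} (hpdf : IsMEDPdf p q) {Θ y : ℝ}
    (hΘ : 0 ≤ Θ) (hy : 0 ≤ y) : ∃ ψ, 0 ≤ ψ ∧ capScalar p q ψ Θ = Real.exp y := by
  have h := intermediate_value_Icc hy (continuous_capScalar p q Θ).continuousOn
  obtain ⟨ψ, hψ, h⟩ := h (show Real.exp y ∈ _ from ⟨by
    simpa [capScalar_zero_left hpdf.pos] using Real.one_le_exp hy,
    exp_le_capScalar hpdf.pos hpdf.nonneg hy hΘ⟩)
  exact ⟨ψ, hψ.1, h⟩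

end HARQ
end

theorem corollary10 {Ω : Type*} [MeasurableSpace Ω] (μ : MeasureTheory.Measure Ω)
    [MeasureTheory.IsProbabilityMeasure μ]
    -- the matrix-exponential effective channel
    {n : ℕ} (p q : Fin n → ℝ) (hpdf : HARQ.IsMEDPdf p q)
    (Z : ℕ → Ω → ℝ) (hZ_meas : ∀ t, Measurable (Z t))
    (hZ_indep : ProbabilityTheory.iIndepFun Z μ)
    (hZ_law : ∀ t, μ.map (Z t) = HARQ.medMeasure p q)
    -- the rate, the decoding threshold, and the QoS-parameter
    (R Θ η ε Dmax ψ : ℝ) (hR : 0 < R) (hΘ : 0 ≤ Θ)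
    (hε : 0 < ε) (hεη : ε < η) (hD : 0 < Dmax) (hψ : ψ = Real.log (η / ε) / Dmax) :
    -- the effective capacity exists at every QoS-exponent
    (∀ θ : ℝ, 0 < θ → ∃ C : ℝ, HARQ.IsEffectiveCapacity μ
      (fun k ω => HARQ.decodedPackets Θ (fun t => Z t ω) k) R θ C) ∧
    -- the denominator of the formula is positive
    1 < HARQ.capScalar p q ψ Θ ∧
    -- the effective capacity at `ψ` exists, is unique, and is given by the formula
    ∀ C : ℝ, HARQ.IsEffectiveCapacityAtQoS μ
        (fun k ω => HARQ.decodedPackets Θ (fun t => Z t ω) k) R ψ C ↔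
      C = R / (ψ⁻¹ * Real.log (HARQ.capScalar p q ψ Θ)) := by
  have hψ0 : 0 < ψ := hψ ▸ div_pos (Real.log_pos ((one_lt_div hε).2 hεη)) hD
  have hW : 1 < HARQ.capScalar p q ψ Θ := (Real.one_lt_exp_iff.2 hψ0).trans_le
    (HARQ.exp_le_capScalar hpdf.pos hpdf.nonneg hψ0.le hΘ)
  have hlog : 0 < Real.log (HARQ.capScalar p q ψ Θ) := Real.log_pos hW
  have hex : ∀ θ : ℝ, 0 < θ → ∃ φ : ℝ, HARQ.capScalar p q φ Θ = Real.exp (θ * R) ∧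
      HARQ.IsEffectiveCapacity μ
        (fun k ω => HARQ.decodedPackets Θ (fun t => Z t ω) k) R θ (φ / θ) := fun θ hθ => by
    obtain ⟨φ, hφ, h⟩ := HARQ.exists_capScalar_eq_exp hpdf hΘ (mul_pos hθ hR).le
    exact ⟨φ, h, HARQ.isEffectiveCapacity_decodedPackets hpdf hZ_meas hZ_indep hZ_law hΘ hφ hR hθ h⟩
  refine ⟨fun θ hθ => ?_, hW, fun C => ⟨?_, ?_⟩⟩
  · obtain ⟨φ, -, h⟩ := hex θ hθ
    exact ⟨_, h⟩
  · rintro ⟨θ, hθ, hC, hθC⟩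
    obtain ⟨φ, hφ, h⟩ := hex θ hθ
    have hCφ : C = φ / θ := tendsto_nhds_unique hC h
    -- Uniqueness of limits identifies `φ` with `ψ`, so no monotonicity of `W` in `ψ` is needed.
    have hφψ : φ = ψ := by rw [← hθC, hCφ]; field_simp
    rw [hCφ, ← hφψ, hφ, Real.log_exp]
    field_simp
  · rintro rfl
    -- This exponent is the solution of `e^{θR} = W(Θ)`.
    have hθ : 0 < Real.log (HARQ.capScalar p q ψ Θ) / R := div_pos hlog hR
    have hval : R / (ψ⁻¹ * Real.log (HARQ.capScalar p q ψ Θ))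
        = ψ / (Real.log (HARQ.capScalar p q ψ Θ) / R) := by
      field_simp
    refine ⟨_, hθ, ?_, ?_⟩
    · rw [hval]
      refine HARQ.isEffectiveCapacity_decodedPackets hpdf hZ_meas hZ_indep hZ_law hΘ hψ0.le hR hθ ?_
      rw [div_mul_cancel₀ _ hR.ne', Real.exp_log (zero_lt_one.trans hW)]
    · rw [hval]
      field_simp
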